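/- Let $d\ge 1$, let $A_1,A_2$ be quantum systems with Hilbert space $\mathbb{C}^d$, and let $F$ be the swap operator on $\mathbb{C}^d\otimes\mathbb{C}^d$, $F(|\psi\rangle\otimes|\phi\rangle)=|\phi\rangle\otimes|\psi\rangle$. Let $|\psi\rangle,|\phi\rangle$ be independent Haar-distributed unit vectors of $\mathbb{C}^d$ (i.e. each distributed according to the unitarily invariant probability measure on the unit sphere), and write $\psi=|\psi\rangle\langle\psi|$, $\phi=|\phi\rangle\langle\phi|$. For a linear map $\Lambda$ on operators on $A_1A_2$, the average fidelity with which it simulates $F$ on this ensemble is $$f(\Lambda)=\int\!\mathrm{d}\psi\int\!\mathrm{d}\phi\ \operatorname{Tr}\big[\Lambda(\psi\otimes\phi)\,(\phi\otimes\psi)\big].$$ Let $\mathrm{LOCC}$ be the set of channels $A_1A_2\to A_1A_2$ implemented by finite protocols of local operations (instruments with finitely many outcomes, performed by one party on its own system with arbitrary finite-dimensional local ancillas) and classical communication between the two parties. Then: 1. Every $\Lambda\in\mathrm{LOCC}$, and more generally every limit of such channels, satisfies $f(\Lambda)\le\left(\frac{2}{d+1}\right)^2$. 2. The bound is attained by measuring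 and preparing each state independently: the channel in which the two parties each measure with the uniform POVM $(d\,\psi\,\mathrm{d}\psi)_\psi$, communicate the outcomes, and each prepare the pure state given by the other party's outcome, i.e. $$\Lambda(X)=d^2\int\!\mathrm{d}\psi\int\!\mathrm{d}\phi\ \operatorname{Tr}\big[X\,(\psi\otimes\phi)\big]\ \phi\otimes\psi ,$$ belongs to $\mathrm{LOCC}$ and satisfies $f(\Lambda)=\left(\frac{2}{d+1}\right)^2$. 3. Consequently the LOCC simulation fidelity of the swap on this ensemble is $$F_{c\ell}:=\sup_{\Lambda\in\mathrm{LOCC}}f(\Lambda)=\left(\frac{2}{d+1}\right)^2 .$$ -/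

import Mathlib

open MeasureTheory
open scoped ComplexOrder

/-- The operator `E ⊗ id` on matrices over a bipartite index set: `E` acts on the first factor. -/
def onFst {a a' b : Type*} (E : Matrix a a ℂ →ₗ[ℂ] Matrix a' a' ℂ) :
    Matrix (a × b) (a × b) ℂ →ₗ[ℂ] Matrix (a' × b) (a' × b) ℂ where
  toFun X := Matrix.of fun p q => E (Matrix.of fun i j => X (i, p.2) (j, q.2)) p.1 q.1
  map_add' X Y := by
    ext p q
    exact congrFun (congrFun (map_add E (Matrix.of fun i j => X (i, p.2) (j, q.2))
      (Matrix.of fun i j => Y (i, p.2) (j, q.2))) p.1) q.1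
  map_smul' c X := by
    ext p q
    exact congrFun (congrFun (map_smul E c
      (Matrix.of fun i j => X (i, p.2) (j, q.2))) p.1) q.1

/-- The operator `id ⊗ E` on matrices over a bipartite index set: `E` acts on the second factor. -/
def onSnd {a b b' : Type*} (E : Matrix b b ℂ →ₗ[ℂ] Matrix b' b' ℂ) :
    Matrix (a × b) (a × b) ℂ →ₗ[ℂ] Matrix (a × b') (a × b') ℂ where
  toFun X := Matrix.of fun p q => E (Matrix.of fun i j => X (p.1, i) (q.1, j)) p.2 q.2
  map_add' X Y := by
    ext p q
    exact congrFun (congrFun (map_add E (Matrix.of fun i j => X (p.1, i) (q.1, j))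
      (Matrix.of fun i j => Y (p.1, i) (q.1, j))) p.2) q.2
  map_smul' c X := by
    ext p q
    exact congrFun (congrFun (map_smul E c
      (Matrix.of fun i j => X (p.1, i) (q.1, j))) p.2) q.2

/-- Complete positivity: `E ⊗ id` preserves positive semidefiniteness for every finite-dimensional
ancilla. -/
def IsCompletelyPositive {m m' : ℕ}
    (E : Matrix (Fin m) (Fin m) ℂ →ₗ[ℂ] Matrix (Fin m') (Fin m') ℂ) : Prop :=
  ∀ (k : ℕ) (X : Matrix (Fin m × Fin k) (Fin m × Fin k) ℂ),
    X.PosSemidef → (onFst E X).PosSemidef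

/-- A quantum instrument with finitely many outcomes `i`: completely positive maps `E i`
(whose output dimension `r i` may depend on the outcome) with trace preserving sum. -/
structure IsInstrument {m k : ℕ} {r : Fin k → ℕ}
    (E : ∀ i, Matrix (Fin m) (Fin m) ℂ →ₗ[ℂ] Matrix (Fin (r i)) (Fin (r i)) ℂ) : Prop where
  completelyPositive : ∀ i, IsCompletelyPositive (E i)
  tracePreserving : ∀ X : Matrix (Fin m) (Fin m) ℂ, ∑ i, (E i X).trace = X.trace

/-- Channels between bipartite systems implemented by a finite protocol of local operations and
classical communication, with output dimensions `m'`, `n'`. A protocol either ends, or one of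
the two parties performs an instrument on their own system (possibly adjoining, processing or
discarding ancillas, as dimensions are arbitrary), announces the outcome `i`, and the protocol
continues with an LOCC protocol `Λ i` that may depend on `i`. -/
inductive IsLOCC {m' n' : ℕ} : {m n : ℕ} →
    (Matrix (Fin m × Fin n) (Fin m × Fin n) ℂ →ₗ[ℂ]
      Matrix (Fin m' × Fin n') (Fin m' × Fin n') ℂ) → Prop
  | idle : IsLOCC LinearMap.id
  | first {m n k : ℕ} {r : Fin k → ℕ}
      (E : ∀ i, Matrix (Fin m) (Fin m) ℂ →ₗ[ℂ] Matrix (Fin (r i)) (Fin (r i)) ℂ)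
      (hE : IsInstrument E)
      (Λ : ∀ i, Matrix (Fin (r i) × Fin n) (Fin (r i) × Fin n) ℂ →ₗ[ℂ]
        Matrix (Fin m' × Fin n') (Fin m' × Fin n') ℂ)
      (hΛ : ∀ i, IsLOCC (Λ i)) :
      IsLOCC (∑ i, (Λ i) ∘ₗ (onFst (E i) :
        Matrix (Fin m × Fin n) (Fin m × Fin n) ℂ →ₗ[ℂ] _))
  | second {m n k : ℕ} {r : Fin k → ℕ}
      (E : ∀ i, Matrix (Fin n) (Fin n) ℂ →ₗ[ℂ] Matrix (Fin (r i)) (Fin (r i)) ℂ)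
      (hE : IsInstrument E)
      (Λ : ∀ i, Matrix (Fin m × Fin (r i)) (Fin m × Fin (r i)) ℂ →ₗ[ℂ]
        Matrix (Fin m' × Fin n') (Fin m' × Fin n') ℂ)
      (hΛ : ∀ i, IsLOCC (Λ i)) :
      IsLOCC (∑ i, (Λ i) ∘ₗ (onSnd (E i) :
        Matrix (Fin m × Fin n) (Fin m × Fin n) ℂ →ₗ[ℂ] _))

/-- Limits of LOCC channels. On these finite-dimensional spaces, pointwise and norm convergence of
linear maps agree. -/
def IsLimitOfLOCC {m n m' n' : ℕ}
    (Λ : Matrix (Fin m × Fin n) (Fin m × Fin n) ℂ →ₗ[ℂ]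
      Matrix (Fin m' × Fin n') (Fin m' × Fin n') ℂ) : Prop :=
  ∃ Λs : ℕ → (Matrix (Fin m × Fin n) (Fin m × Fin n) ℂ →ₗ[ℂ]
      Matrix (Fin m' × Fin n') (Fin m' × Fin n') ℂ),
    (∀ t, IsLOCC (Λs t)) ∧
    ∀ X, Filter.Tendsto (fun t => Λs t X) Filter.atTop (nhds (Λ X))

/-- The rank-one operator `|ψ⟩⟨ψ|`. -/
def pureState {ι : Type*} (ψ : EuclideanSpace ℂ ι) : Matrix ι ι ℂ :=
  Matrix.vecMulVec ψ.ofLp (star ψ.ofLp)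

section Fidelity

variable {Ω : Type*} [MeasurableSpace Ω] {m n m' n' : ℕ}

/-- The average fidelity `∫ Tr[Λ(ψ_α) U ψ_α U†] dμ(α)` with which `Λ` simulates the isometry `U` on
the ensemble of pure states `ψ_α`, with `α` distributed according to `μ`. -/
noncomputable def averageFidelity (μ : Measure Ω)
    (ψ : Ω → EuclideanSpace ℂ (Fin m × Fin n))
    (U : EuclideanSpace ℂ (Fin m × Fin n) →ₗᵢ[ℂ] EuclideanSpace ℂ (Fin m' × Fin n'))
    (Λ : Matrix (Fin m × Fin n) (Fin m × Fin n) ℂ →ₗ[ℂ]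
      Matrix (Fin m' × Fin n') (Fin m' × Fin n') ℂ) : ℝ :=
  ∫ α, (Matrix.trace (Λ (pureState (ψ α)) * pureState (U (ψ α)))).re ∂μ

/-- The LOCC simulation fidelity of `U` on the ensemble `(μ, ψ)`. -/
noncomputable def simulationFidelity (μ : Measure Ω)
    (ψ : Ω → EuclideanSpace ℂ (Fin m × Fin n))
    (U : EuclideanSpace ℂ (Fin m × Fin n) →ₗᵢ[ℂ] EuclideanSpace ℂ (Fin m' × Fin n')) : ℝ :=
  sSup (averageFidelity μ ψ U '' {Λ | IsLOCC Λ})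

end Fidelity

/-- The unit sphere of `ℂ^d`, i.e. normalised state vectors of a qudit. -/
abbrev StateVector (d : ℕ) : Type := Metric.sphere (0 : EuclideanSpace ℂ (Fin d)) 1

/-- The Haar (unitarily invariant) probability measure on qudit state vectors: the normalised
surface measure on the unit sphere of `ℂ^d`. -/
noncomputable def haarState (d : ℕ) : Measure (StateVector d) :=
  ((volume : Measure (EuclideanSpace ℂ (Fin d))).toSphere Set.univ)⁻¹ •
    (volume : Measure (EuclideanSpace ℂ (Fin d))).toSphere

/-- The product vector `|ψ⟩ ⊗ |φ⟩`. -/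
def productVector {a b : Type*} (ψ : EuclideanSpace ℂ a) (φ : EuclideanSpace ℂ b) :
    EuclideanSpace ℂ (a × b) :=
  WithLp.toLp 2 fun p => ψ p.1 * φ p.2

/-- The swap operator on two qudits. -/
noncomputable def swapOperator (d : ℕ) :
    EuclideanSpace ℂ (Fin d × Fin d) →ₗᵢ[ℂ] EuclideanSpace ℂ (Fin d × Fin d) :=
  (LinearIsometryEquiv.piLpCongrLeft 2 ℂ ℂ (Equiv.prodComm (Fin d) (Fin d))).toLinearIsometry

theorem swapOperator_productVector {d : ℕ} (ψ φ : EuclideanSpace ℂ (Fin d)) :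
    swapOperator d (productVector ψ φ) = productVector φ ψ := by
  ext p
  exact mul_comm _ _

/-! The fidelity depends on the Haar measure only through the second moments `ψ_i ψ_j ψ̄_k ψ̄_l`,
whose mean is `(δ_ik δ_jl + δ_il δ_jk) / (d (d + 1))` (`integral_moment`). So `f` is a finite linear
functional of the matrix elements of the channel (`averageFidelity_swap`), hence continuous, and the
bound passes to limits.

For the upper bound only separability and trace preservation are used. A finite LOCC protocol has
product Kraus operators `A_t ⊗ B_t` (`IsLOCC.exists_product_kraus`). Each contributes `(‖A‖²‖B‖² +
‖BA‖² + ‖AB‖² + |Tr AB|²) / (d (d + 1))²` in Hilbert–Schmidt norms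
(`sum_krausMap_mul_symmetricTensor`). Submultiplicativity and Cauchy–Schwarz bound every summand by
`‖A‖²‖B‖²`, and taking the trace of the image of the identity gives `∑ ‖A_t‖²‖B_t‖² = d²`. The total
is at most `4 d² / (d (d + 1))² = (2 / (d + 1))²`.

For attainment, the uniform POVM has a continuum of outcomes while protocols are finite. But the
measure-and-prepare channel also depends only on second moments, so a finite weighted 2-design
(`exists_finite_design`) implements exactly the same channel. All four terms of the fidelity then
coincide (`averageFidelity_swap_eq`). -/

/-! ### Isometry invariance of the surface measure on a sphere -/

section SphereInvariance

variable {E : Type*} [NormedAddCommGroup E] [InnerProductSpace ℝ E] [FiniteDimensional ℝ E]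
  [MeasurableSpace E] [BorelSpace E]

/-- A linear isometry acts on the unit sphere. -/
def sphereMap (V : E ≃ₗᵢ[ℝ] E) (x : Metric.sphere (0 : E) 1) : Metric.sphere (0 : E) 1 :=
  ⟨V x, by simp⟩

omit [FiniteDimensional ℝ E] [MeasurableSpace E] [BorelSpace E] in
theorem continuous_sphereMap (V : E ≃ₗᵢ[ℝ] E) : Continuous (sphereMap V) :=
  (V.continuous.comp continuous_subtype_val).subtype_mk _

open scoped Pointwise in
-- The surface measure of a set is a multiple of the volume of the cone over it. A linear isometry
-- commutes with forming cones and preserves volume.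
theorem measurePreserving_sphereMap (V : E ≃ₗᵢ[ℝ] E) :
    MeasurePreserving (sphereMap V) (volume : Measure E).toSphere
      (volume : Measure E).toSphere := by
  refine ⟨(continuous_sphereMap V).measurable, ?_⟩
  ext s hs
  have hm := (continuous_sphereMap V).measurable
  rw [Measure.map_apply hm hs, Measure.toSphere_apply' _ (hm hs), Measure.toSphere_apply' _ hs,
    ← V.measurePreserving.measure_preimage_emb V.toHomeomorph.measurableEmbedding
      (Set.Ioo (0 : ℝ) 1 • (Subtype.val '' s))]
  congr 2
  ext x
  simp only [Set.mem_smul, Set.mem_image, Set.mem_preimage]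
  constructor
  · rintro ⟨t, ht, _, ⟨y, hy, rfl⟩, rfl⟩
    exact ⟨t, ht, _, ⟨_, hy, rfl⟩, by simp [sphereMap]⟩
  · rintro ⟨t, ht, _, ⟨y, hy, rfl⟩, h⟩
    refine ⟨t, ht, _, ⟨sphereMap V.symm y, ?_, rfl⟩, ?_⟩
    · convert hy
      ext
      simp [sphereMap]
    · apply V.injective
      simpa [sphereMap] using h

end SphereInvariance

/-! ### Second moments of the Haar measure -/

section HaarMoments

variable {d : ℕ}

theorem isProbabilityMeasure_haarState (hd : 1 ≤ d) : IsProbabilityMeasure (haarState d) := by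
  have : Nonempty (Fin d) := ⟨⟨0, hd⟩⟩
  have : NeZero (volume : Measure (EuclideanSpace ℂ (Fin d))).toSphere :=
    ⟨Measure.toSphere_ne_zero _⟩
  unfold haarState
  infer_instance

/-- Real-linear isometries suffice as symmetries, since the measure comes from the underlying real
sphere. Nothing is asked of `f`, because the action is a measurable equivalence. -/
theorem integral_haarState_comp (V : EuclideanSpace ℂ (Fin d) ≃ₗᵢ[ℝ] EuclideanSpace ℂ (Fin d))
    (f : EuclideanSpace ℂ (Fin d) → ℂ) :
    ∫ x : StateVector d, f (V x) ∂haarState d = ∫ x : StateVector d, f x ∂haarState d := by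
  have h := (measurePreserving_sphereMap V).integral_comp'
    (f := (⟨⟨sphereMap V, sphereMap V.symm, fun x => by ext; simp [sphereMap],
      fun x => by ext; simp [sphereMap]⟩, (continuous_sphereMap V).measurable,
      (continuous_sphereMap V.symm).measurable⟩ : StateVector d ≃ᵐ StateVector d))
    (fun x : StateVector d => f x)
  simp only [haarState, integral_smul_measure]
  congr 1

/-- The second moment `ψ_i ψ_j ψ̄_k ψ̄_l` of a state vector. -/
def moment (x : EuclideanSpace ℂ (Fin d)) (i j k l : Fin d) : ℂ :=
  x i * x j * (star (x k) * star (x l))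

/-- The components of the normalised projection onto the symmetric subspace. -/
noncomputable def symmetricTensor (d : ℕ) (i j k l : Fin d) : ℂ :=
  ((if i = k ∧ j = l then 1 else 0) + (if i = l ∧ j = k then 1 else 0)) / (d * (d + 1))

/-- Multiplication of the coordinate `a` by the imaginary unit. -/
noncomputable def phaseFactor (a i : Fin d) : ℂ := if i = a then Complex.I else 1

theorem eq_zero_of_phaseFactor_mul {M : ℂ} {a i j k l : Fin d}
    (h : M = phaseFactor a i * phaseFactor a j *
      (star (phaseFactor a k) * star (phaseFactor a l)) * M)
    (ha : phaseFactor a i * phaseFactor a j *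
      (star (phaseFactor a k) * star (phaseFactor a l)) ≠ 1) : M = 0 := by
  by_contra h0
  exact ha (mul_right_cancel₀ h0 (h.symm.trans (one_mul _).symm))

theorem I_ne_one : Complex.I ≠ 1 := fun h => by simpa using congrArg Complex.im h

/-- A criterion shared by the Haar measure and the finite design. The number of occurrences of `a`
among `i, j` minus that among `k, l` lies between `-2` and `2`, so a fourth root of unity already
detects when it is nonzero. Only index pairs agreeing up to order survive, and `hsymm` reduces these
to the values given by `h4` and `h22`. -/
theorem eq_symmetricTensor {M : Fin d → Fin d → Fin d → Fin d → ℂ}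
    (hphase : ∀ a i j k l, M i j k l = phaseFactor a i * phaseFactor a j *
      (star (phaseFactor a k) * star (phaseFactor a l)) * M i j k l)
    (hsymm : ∀ i j k l, M i j k l = M i j l k)
    (h4 : ∀ i, M i i i i = 2 / (d * (d + 1)))
    (h22 : ∀ i j, i ≠ j → M i j i j = 1 / (d * (d + 1))) (i j k l : Fin d) :
    M i j k l = symmetricTensor d i j k l := by
  have key : ∀ a, phaseFactor a i * phaseFactor a j *
      (star (phaseFactor a k) * star (phaseFactor a l)) ≠ 1 → M i j k l = 0 :=
    fun a => eq_zero_of_phaseFactor_mul (hphase a i j k l)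
  have hI1 := I_ne_one
  have hI2 : (-1 : ℂ) ≠ 1 := by norm_num
  have hi := key i
  have hj := key j
  unfold symmetricTensor
  by_cases hik : i = k
  · subst hik
    by_cases hjl : j = l
    · subst hjl
      by_cases hij : i = j
      · subst hij
        rw [h4]; norm_num
      · rw [h22 i j hij]; simp [hij]
    · rw [hj ?_]
      · have : ¬ (i = l ∧ j = i) := fun h => hjl (h.2.trans h.1)
        simp [this, hjl]
      · by_cases hij : i = j <;> simp [phaseFactor, hij, Ne.symm hjl, hI1]
  · by_cases hil : i = l
    · subst hil
      by_cases hjk : j = k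
      · subst hjk
        rw [hsymm, h22 i j hik]; simp [hik]
      · rw [hj ?_]
        · simp [hik, hjk]
        · by_cases hij : i = j <;> simp [phaseFactor, hij, Ne.symm hjk, hI1]
    -- Here `i` is matched by neither `k` nor `l`, so the phase on coordinate `i` is `I`, or `I² =
    -- -1` if `j = i`.
    · rw [hi ?_]
      · simp [hik, hil]
      · by_cases hij : j = i <;> simp [phaseFactor, hij, Ne.symm hik, Ne.symm hil, hI1, hI2]

theorem continuous_moment (i j k l : Fin d) :
    Continuous fun x : StateVector d => moment x.1 i j k l := by
  unfold moment
  fun_prop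

theorem integrable_of_continuous {X : Type*} [TopologicalSpace X] [CompactSpace X]
    [MeasurableSpace X] [OpensMeasurableSpace X] {μ : Measure X} [IsFiniteMeasure μ] {f : X → ℂ}
    (hf : Continuous f) : Integrable f μ :=
  hf.integrable_of_hasCompactSupport (HasCompactSupport.of_compactSpace f)

/-- The orthogonal map `(x_a, x_b) ↦ ((3 x_a + 4 x_b) / 5, (4 x_a - 3 x_b) / 5)`. -/
noncomputable def mixFun (a b : Fin d) (x : EuclideanSpace ℂ (Fin d)) :
    EuclideanSpace ℂ (Fin d) :=
  WithLp.toLp 2 fun i => if i = a then (3 * x a + 4 * x b) / 5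
    else if i = b then (4 * x a - 3 * x b) / 5 else x i

theorem mixFun_mixFun {a b : Fin d} (hab : a ≠ b) (x : EuclideanSpace ℂ (Fin d)) :
    mixFun a b (mixFun a b x) = x := by
  ext i
  by_cases hi : i = a
  · subst hi; simp [mixFun, hab.symm]; ring
  · by_cases hi' : i = b
    · subst hi'; simp [mixFun, hi]; ring
    · simp [mixFun, hi, hi']

theorem norm_mixFun {a b : Fin d} (hab : a ≠ b) (x : EuclideanSpace ℂ (Fin d)) :
    ‖mixFun a b x‖ = ‖x‖ := by
  rw [EuclideanSpace.norm_eq, EuclideanSpace.norm_eq]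
  congr 1
  have hb : b ∈ Finset.univ.erase a := by simp [hab.symm]
  rw [← Finset.add_sum_erase _ _ (Finset.mem_univ a), ← Finset.add_sum_erase _ _ hb,
    ← Finset.add_sum_erase _ (fun i => ‖x i‖ ^ 2) (Finset.mem_univ a),
    ← Finset.add_sum_erase _ (fun i => ‖x i‖ ^ 2) hb, ← add_assoc, ← add_assoc]
  congr 1
  · simp only [mixFun, hab.symm, if_true, if_false, Complex.sq_norm, Complex.normSq_apply]
    simp
    ring
  · refine Finset.sum_congr rfl fun i hi => ?_
    simp only [Finset.mem_erase] at hi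
    simp [mixFun, hi.1, hi.2.1]

noncomputable def mixIsometry {a b : Fin d} (hab : a ≠ b) :
    EuclideanSpace ℂ (Fin d) ≃ₗᵢ[ℝ] EuclideanSpace ℂ (Fin d) where
  toFun := mixFun a b
  invFun := mixFun a b
  left_inv := mixFun_mixFun hab
  right_inv := mixFun_mixFun hab
  map_add' x y := by
    ext i
    simp only [mixFun, PiLp.add_apply]
    split_ifs <;> ring
  map_smul' c x := by
    ext i
    simp only [mixFun, PiLp.smul_apply, Complex.real_smul, RingHom.id_apply]
    split_ifs <;> ring
  norm_map' := norm_mixFun hab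

/-- The imaginary unit as a point of the unit circle. -/
noncomputable def circleI : Circle :=
  ⟨Complex.I, (mem_sphere_zero_iff_norm.2 Complex.norm_I : Complex.I ∈ Metric.sphere (0 : ℂ) 1)⟩

theorem coe_circleI : (circleI : ℂ) = Complex.I := rfl

noncomputable def phaseIsometry (a : Fin d) :
    EuclideanSpace ℂ (Fin d) ≃ₗᵢ[ℝ] EuclideanSpace ℂ (Fin d) :=
  LinearIsometryEquiv.piLpCongrRight 2 fun i =>
    if i = a then rotation circleI else LinearIsometryEquiv.refl ℝ ℂ

theorem phaseIsometry_apply (a i : Fin d) (x : EuclideanSpace ℂ (Fin d)) :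
    phaseIsometry a x i = phaseFactor a i * x i := by
  simp only [phaseIsometry, LinearIsometryEquiv.piLpCongrRight_apply, phaseFactor]
  split_ifs <;> simp [coe_circleI]

theorem haarMoment_phase (a i j k l : Fin d) :
    ∫ x : StateVector d, moment x.1 i j k l ∂haarState d = phaseFactor a i * phaseFactor a j *
      (star (phaseFactor a k) * star (phaseFactor a l)) *
        ∫ x : StateVector d, moment x.1 i j k l ∂haarState d := by
  conv_lhs => rw [← integral_haarState_comp (phaseIsometry a) (fun x => moment x i j k l)]
  rw [← integral_const_mul]
  refine integral_congr_ae (.of_forall fun x => ?_)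
  simp only [moment, phaseIsometry_apply, star_mul']
  ring

theorem haarMoment_eq_zero {i j k l : Fin d} (a : Fin d)
    (ha : phaseFactor a i * phaseFactor a j *
      (star (phaseFactor a k) * star (phaseFactor a l)) ≠ 1) :
    ∫ x : StateVector d, moment x.1 i j k l ∂haarState d = 0 :=
  eq_zero_of_phaseFactor_mul (haarMoment_phase a i j k l) ha

/-- Expanding both squares gives nine moments. Phase invariance kills those with unequal numbers of
`a` before and after conjugation. The coefficient `4 s² t²` is the product of the two cross terms `2
s t`. -/
theorem integral_moment_mix (hd : 1 ≤ d) {a b : Fin d} (hab : a ≠ b) (s t : ℂ) :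
    ∫ x : StateVector d, ((s * x.1 a + t * x.1 b) ^ 2 *
        (s * star (x.1 a) + t * star (x.1 b)) ^ 2) ∂haarState d =
      s ^ 4 * (∫ x : StateVector d, moment x.1 a a a a ∂haarState d) +
      t ^ 4 * (∫ x : StateVector d, moment x.1 b b b b ∂haarState d) +
      4 * s ^ 2 * t ^ 2 * (∫ x : StateVector d, moment x.1 a b a b ∂haarState d) := by
  have := isProbabilityMeasure_haarState hd
  have e : ∀ x : StateVector d, (s * x.1 a + t * x.1 b) ^ 2 *
      (s * star (x.1 a) + t * star (x.1 b)) ^ 2 =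
      s ^ 4 * moment x.1 a a a a + t ^ 4 * moment x.1 b b b b +
      4 * s ^ 2 * t ^ 2 * moment x.1 a b a b +
      2 * s ^ 3 * t * moment x.1 a a a b + 2 * s ^ 3 * t * moment x.1 a b a a +
      s ^ 2 * t ^ 2 * moment x.1 a a b b + s ^ 2 * t ^ 2 * moment x.1 b b a a +
      2 * s * t ^ 3 * moment x.1 a b b b + 2 * s * t ^ 3 * moment x.1 b b a b := by
    intro x
    simp only [moment]
    ring
  have hI1 := I_ne_one
  have hI2 : (-1 : ℂ) ≠ 1 := by norm_num
  have hI3 : -(Complex.I : ℂ) ≠ 1 := fun h => by simpa using congrArg Complex.im h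
  simp only [e]
  repeat rw [integral_add]
  · simp only [integral_const_mul]
    rw [haarMoment_eq_zero (i := a) (j := a) (k := a) (l := b) b,
      haarMoment_eq_zero (i := a) (j := b) (k := a) (l := a) b,
      haarMoment_eq_zero (i := a) (j := a) (k := b) (l := b) b,
      haarMoment_eq_zero (i := b) (j := b) (k := a) (l := a) b,
      haarMoment_eq_zero (i := a) (j := b) (k := b) (l := b) a,
      haarMoment_eq_zero (i := b) (j := b) (k := a) (l := b) a]
    · ring
    all_goals simp [phaseFactor, hab, hab.symm, hI1, hI2, hI3]
  all_goals
    apply integrable_of_continuous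
    unfold moment
    fun_prop

/-- Invariance under the reflection with entries `3/5, 4/5`, chosen to avoid square roots, gives two
linear equations for the moments `aaaa`, `bbbb` and `abab`. They determine the three up to a common
factor. -/
theorem haarMoment_diag (hd : 1 ≤ d) {a b : Fin d} (hab : a ≠ b) :
    ∫ x : StateVector d, moment x.1 a a a a ∂haarState d =
        ∫ x : StateVector d, moment x.1 b b b b ∂haarState d ∧
      ∫ x : StateVector d, moment x.1 a a a a ∂haarState d =
        2 * ∫ x : StateVector d, moment x.1 a b a b ∂haarState d := by
  have ha := integral_moment_mix hd hab (3 / 5) (4 / 5)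
  have hb := integral_moment_mix hd hab (4 / 5) (-3 / 5)
  have ha' := integral_haarState_comp (mixIsometry hab) (fun x => moment x a a a a)
  have hb' := integral_haarState_comp (mixIsometry hab) (fun x => moment x b b b b)
  have ea : ∀ x : StateVector d, moment (mixIsometry hab x.1) a a a a =
      (3 / 5 * x.1 a + 4 / 5 * x.1 b) ^ 2 *
        (3 / 5 * star (x.1 a) + 4 / 5 * star (x.1 b)) ^ 2 := by
    intro x
    have : mixIsometry hab x.1 a = (3 * x.1 a + 4 * x.1 b) / 5 := by
      simp [mixIsometry, mixFun]
    simp only [moment, this]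
    simp
    ring
  have eb : ∀ x : StateVector d, moment (mixIsometry hab x.1) b b b b =
      (4 / 5 * x.1 a + -3 / 5 * x.1 b) ^ 2 *
        (4 / 5 * star (x.1 a) + -3 / 5 * star (x.1 b)) ^ 2 := by
    intro x
    have : mixIsometry hab x.1 b = (4 * x.1 a - 3 * x.1 b) / 5 := by
      simp [mixIsometry, mixFun, hab.symm]
    simp only [moment, this]
    simp
    ring
  simp only [ea] at ha'
  simp only [eb] at hb'
  rw [ha] at ha'
  rw [hb] at hb'
  constructor
  -- Subtracting the equations leaves `800/625` times the difference of the two diagonal moments.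
  · linear_combination (-625 / 800 : ℂ) * ha' + (625 / 800 : ℂ) * hb'
  -- The weights `544` and `256` eliminate the `bbbb` moment, and `230400 = 544² - 256²`.
  · linear_combination (-625 * 544 / 230400 : ℂ) * ha' - (625 * 256 / 230400 : ℂ) * hb'

theorem sum_mul_star_of_norm_eq_one {x : EuclideanSpace ℂ (Fin d)} (hx : ‖x‖ = 1) :
    ∑ i, x i * star (x i) = 1 := by
  have h := EuclideanSpace.norm_sq_eq x
  rw [hx, one_pow] at h
  have h' := congrArg (fun r : ℝ => (r : ℂ)) h
  simp only [Complex.ofReal_one, Complex.ofReal_sum] at h'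
  rw [h']
  refine Finset.sum_congr rfl fun i _ => ?_
  rw [Complex.star_def, Complex.mul_conj, Complex.normSq_eq_norm_sq]

theorem integral_moment (hd : 1 ≤ d) (i j k l : Fin d) :
    ∫ x : StateVector d, moment x.1 i j k l ∂haarState d = symmetricTensor d i j k l := by
  have := isProbabilityMeasure_haarState hd
  let M : Fin d → Fin d → Fin d → Fin d → ℂ :=
    fun i j k l => ∫ x : StateVector d, moment x.1 i j k l ∂haarState d
  -- The normalisation: the full contraction of the moments is the integral of `‖x‖⁴ = 1`.
  have hsum : ∑ i, ∑ j, M i j i j = 1 := by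
    simp only [M]
    simp_rw [← integral_finsetSum _ fun j _ => integrable_of_continuous (continuous_moment _ _ _ _)]
    rw [← integral_finsetSum]
    · have : ∀ x : StateVector d, ∑ i, ∑ j, moment x.1 i j i j = 1 := by
        intro x
        have h := sum_mul_star_of_norm_eq_one (mem_sphere_zero_iff_norm.1 x.2)
        calc _ = (∑ i, x.1 i * star (x.1 i)) * ∑ i, x.1 i * star (x.1 i) := by
              rw [Finset.sum_mul_sum]
              refine Finset.sum_congr rfl fun i _ => Finset.sum_congr rfl fun j _ => ?_
              simp only [moment]
              ring
          _ = 1 := by rw [h, one_mul]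
      simp [this]
    · intro i _
      exact integrable_of_continuous (continuous_finsetSum _ fun j _ => continuous_moment _ _ _ _)
  have hd0 : (d : ℂ) ≠ 0 := by exact_mod_cast (by omega : d ≠ 0)
  have hd1 : (d : ℂ) + 1 ≠ 0 := by exact_mod_cast (by omega : d + 1 ≠ 0)
  have hval : ∀ a, M a a a a = 2 / (d * (d + 1)) := by
    intro a
    -- With `m` the common diagonal moment, the contraction becomes `(d² + d) m / 2`, which fixes
    -- `m`.
    have hM : ∀ i j, M i j i j = M a a a a / 2 + if i = j then M a a a a / 2 else 0 := by
      intro i j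
      have hi : M a a a a = M i i i i := by
        by_cases h : a = i
        · rw [h]
        · exact (haarMoment_diag hd h).1
      by_cases hij : i = j
      · subst hij
        rw [if_pos rfl, ← hi]; ring
      · have h2 : M i i i i = 2 * M i j i j := (haarMoment_diag hd hij).2
        rw [if_neg hij, hi, h2]; ring
    rw [Finset.sum_congr rfl fun i _ => Finset.sum_congr rfl fun j _ => hM i j] at hsum
    simp only [Finset.sum_add_distrib, Finset.sum_ite_eq, Finset.mem_univ, if_true,
      Finset.sum_const, Finset.card_univ, Fintype.card_fin, nsmul_eq_mul] at hsum
    rw [eq_div_iff (mul_ne_zero hd0 hd1)]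
    linear_combination 2 * hsum
  refine eq_symmetricTensor (M := M) (fun a i j k l => haarMoment_phase a i j k l) ?_ hval ?_ i j k l
  · intro i j k l
    simp only [M, moment]
    congr 1 with x
    ring
  · intro i j hij
    have h1 := hval i
    have h2 : M i i i i = 2 * M i j i j := (haarMoment_diag hd hij).2
    rw [h2] at h1
    linear_combination h1 / 2

end HaarMoments

/-! ### A finite weighted complex projective 2-design -/

section Design

variable {d : ℕ}

/-- The normalised vector with coordinates `i ^ (k a)`. -/
noncomputable def phaseVector (k : Fin d → ZMod 4) : EuclideanSpace ℂ (Fin d) :=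
  WithLp.toLp 2 fun a => Complex.I ^ (k a).val * ((√d : ℝ) : ℂ)⁻¹

theorem phaseVector_mul_star (k : Fin d → ZMod 4) (a : Fin d) :
    phaseVector k a * star (phaseVector k a) = (d : ℂ)⁻¹ := by
  have h1 : Complex.I ^ (k a).val * star (Complex.I ^ (k a).val) = 1 := by
    rw [star_pow, ← mul_pow]
    simp
  have h2 : ((√d : ℝ) : ℂ) * ((√d : ℝ) : ℂ) = d := by
    rw [← Complex.ofReal_mul, Real.mul_self_sqrt (Nat.cast_nonneg d), Complex.ofReal_natCast]
  calc phaseVector k a * star (phaseVector k a) =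
        (Complex.I ^ (k a).val * star (Complex.I ^ (k a).val)) *
          (((√d : ℝ) : ℂ) * ((√d : ℝ) : ℂ))⁻¹ := by
        simp only [phaseVector, star_mul', mul_inv]
        simp
        ring
    _ = _ := by rw [h1, h2, one_mul]

theorem norm_phaseVector (hd : 1 ≤ d) (k : Fin d → ZMod 4) : ‖phaseVector k‖ = 1 := by
  have hd0 : (d : ℝ) ≠ 0 := by exact_mod_cast (by omega : d ≠ 0)
  have h : ∀ a, ‖phaseVector k a‖ ^ 2 = (d : ℝ)⁻¹ := by
    intro a
    have := phaseVector_mul_star k a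
    rw [Complex.star_def, Complex.mul_conj, Complex.normSq_eq_norm_sq] at this
    exact Complex.ofReal_injective (by simpa using this)
  rw [EuclideanSpace.norm_eq]
  simp [h, hd0]

theorem I_pow_val_add_one (k : ZMod 4) :
    Complex.I ^ (k + 1).val = Complex.I * Complex.I ^ k.val := by
  fin_cases k
  · change Complex.I ^ 1 = Complex.I * Complex.I ^ 0; simp
  · change Complex.I ^ 2 = Complex.I * Complex.I ^ 1; simp
  · change Complex.I ^ 3 = Complex.I * Complex.I ^ 2; ring
  · change Complex.I ^ 0 = Complex.I * Complex.I ^ 3; rw [← pow_succ']; simp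

theorem phaseVector_add_single (k : Fin d → ZMod 4) (a i : Fin d) :
    phaseVector (k + Pi.single a 1) i = phaseFactor a i * phaseVector k i := by
  by_cases h : i = a
  · subst h
    simp [phaseVector, phaseFactor, I_pow_val_add_one]
    ring
  · simp [phaseVector, phaseFactor, h]

/-- The vectors of an explicit weighted complex projective 2-design. -/
noncomputable def designVector : Fin d ⊕ (Fin d → ZMod 4) → EuclideanSpace ℂ (Fin d)
  | .inl b => EuclideanSpace.single b 1
  | .inr k => phaseVector k

/-- The weights of an explicit weighted complex projective 2-design. -/
noncomputable def designWeight : Fin d ⊕ (Fin d → ZMod 4) → ℝ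
  | .inl _ => 1 / (d * (d + 1))
  | .inr _ => d / ((d + 1) * 4 ^ d)

/-- Every phase vector has flat modulus, so together they give `1 / (d (d + 1))` to all moments
`ijij`. The basis vectors supply the same amount again when `i = j`. Phase covariance holds because
shifting one exponent permutes the phase vectors, and a basis vector has only the nonzero moment
`bbbb`, whose phases cancel. -/
theorem sum_designWeight_mul_moment (hd : 1 ≤ d) (i j k l : Fin d) :
    ∑ s, (designWeight s : ℂ) * moment (designVector s) i j k l = symmetricTensor d i j k l := by
  have hd0 : (d : ℂ) ≠ 0 := by exact_mod_cast (by omega : d ≠ 0)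
  have hd1 : (d : ℂ) + 1 ≠ 0 := by exact_mod_cast (by omega : d + 1 ≠ 0)
  have hpair : ∀ i j : Fin d, ∑ f : Fin d → ZMod 4,
      (designWeight (Sum.inr f) : ℂ) * moment (phaseVector f) i j i j = 1 / (d * (d + 1)) := by
    intro i j
    have : ∀ f : Fin d → ZMod 4, moment (phaseVector f) i j i j = (d : ℂ)⁻¹ * (d : ℂ)⁻¹ := by
      intro f
      calc moment (phaseVector f) i j i j = (phaseVector f i * star (phaseVector f i)) *
            (phaseVector f j * star (phaseVector f j)) := by
            simp only [moment]
            ring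
        _ = _ := by rw [phaseVector_mul_star, phaseVector_mul_star]
    simp only [this, designWeight, Finset.sum_const, Finset.card_univ, Fintype.card_fun,
      ZMod.card, Fintype.card_fin, nsmul_eq_mul]
    push_cast
    field_simp
  refine eq_symmetricTensor
    (M := fun i j k l => ∑ s, (designWeight s : ℂ) * moment (designVector s) i j k l)
    ?_ ?_ ?_ ?_ i j k l
  · intro a i j k l
    simp only [Fintype.sum_sum_type, designVector, mul_add, Finset.mul_sum]
    congr 1
    · refine Finset.sum_congr rfl fun b _ => ?_
      by_cases h : i = b ∧ j = b ∧ k = b ∧ l = b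
      · obtain ⟨rfl, rfl, rfl, rfl⟩ := h
        by_cases hla : l = a <;> simp [phaseFactor, hla]
      · have : moment (EuclideanSpace.single b (1 : ℂ)) i j k l = 0 := by
          simp only [moment, PiLp.single_apply]
          by_contra hne
          apply h
          simp only [mul_eq_zero, star_eq_zero, not_or, ite_eq_right_iff, one_ne_zero,
            imp_false, not_not] at hne
          tauto
        simp [this]
    · rw [← Equiv.sum_comp (Equiv.addRight (Pi.single a (1 : ZMod 4)))]
      refine Finset.sum_congr rfl fun f _ => ?_
      simp only [designWeight, moment, Equiv.coe_addRight, phaseVector_add_single, star_mul']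
      ring
  · intro i j k l
    simp only [moment]
    refine Finset.sum_congr rfl fun s _ => ?_
    ring
  · intro i
    simp only [Fintype.sum_sum_type, designVector, hpair]
    simp [moment, designWeight, PiLp.single_apply]
    field_simp
    norm_num
  · intro i j hij
    simp only [Fintype.sum_sum_type, designVector, hpair]
    simp [moment, hij, PiLp.single_apply, designWeight]

/-- A finite weighted ensemble of states with the same second moments as the Haar measure. -/
theorem exists_finite_design (hd : 1 ≤ d) : ∃ (n : ℕ) (w : Fin n → ℝ)
    (x : Fin n → EuclideanSpace ℂ (Fin d)), (∀ s, 0 ≤ w s) ∧ (∀ s, ‖x s‖ = 1) ∧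
      ∀ i j k l, ∑ s, (w s : ℂ) * moment (x s) i j k l = symmetricTensor d i j k l := by
  let e := Fintype.equivFin (Fin d ⊕ (Fin d → ZMod 4))
  refine ⟨_, designWeight ∘ e.symm, designVector ∘ e.symm, fun s => ?_, fun s => ?_,
    fun i j k l => ?_⟩
  · rcases h : e.symm s with b | f <;> simp only [Function.comp, h, designWeight] <;> positivity
  · rcases h : e.symm s with b | f <;> simp only [Function.comp, h, designVector]
    · simp
    · exact norm_phaseVector hd f
  · rw [← sum_designWeight_mul_moment hd]
    exact Equiv.sum_comp e.symm
      (fun s => (designWeight s : ℂ) * moment (designVector s) i j k l)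

end Design

/-! ### Kraus operators and Hilbert–Schmidt estimates -/

section Kraus

open scoped Kronecker

/-- The completely positive map `X ↦ K X K†`. -/
def krausMap {a b : Type*} [Fintype a] (K : Matrix b a ℂ) :
    Matrix a a ℂ →ₗ[ℂ] Matrix b b ℂ where
  toFun X := K * X * K.conjTranspose
  map_add' X Y := by rw [Matrix.mul_add, Matrix.add_mul]
  map_smul' c X := by simp

theorem krausMap_apply {a b : Type*} [Fintype a] (K : Matrix b a ℂ) (X : Matrix a a ℂ) :
    krausMap K X = K * X * K.conjTranspose := rfl

theorem krausMap_mul {a b c : Type*} [Fintype a] [Fintype b] (K : Matrix b a ℂ)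
    (L : Matrix c b ℂ) (X : Matrix a a ℂ) :
    krausMap L (krausMap K X) = krausMap (L * K) X := by
  simp only [krausMap_apply, Matrix.conjTranspose_mul, Matrix.mul_assoc]

theorem onFst_eq_sum {a a' b ι : Type*} [Fintype a] [Fintype b] [DecidableEq b] [Fintype ι]
    {E : Matrix a a ℂ →ₗ[ℂ] Matrix a' a' ℂ} {K : ι → Matrix a' a ℂ}
    (hE : ∀ X, E X = ∑ t, krausMap (K t) X) (X : Matrix (a × b) (a × b) ℂ) :
    onFst E X = ∑ t, krausMap (K t ⊗ₖ (1 : Matrix b b ℂ)) X := by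
  ext ⟨p1, p2⟩ ⟨q1, q2⟩
  simp [onFst, hE, krausMap_apply, Matrix.sum_apply, Matrix.mul_apply, Fintype.sum_prod_type,
    Matrix.one_apply, apply_ite (starRingEnd ℂ)]

theorem onSnd_eq_sum {a b b' ι : Type*} [Fintype a] [Fintype b] [DecidableEq a] [Fintype ι]
    {E : Matrix b b ℂ →ₗ[ℂ] Matrix b' b' ℂ} {K : ι → Matrix b' b ℂ}
    (hE : ∀ X, E X = ∑ t, krausMap (K t) X) (X : Matrix (a × b) (a × b) ℂ) :
    onSnd E X = ∑ t, krausMap ((1 : Matrix a a ℂ) ⊗ₖ K t) X := by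
  ext ⟨p1, p2⟩ ⟨q1, q2⟩
  simp [onSnd, hE, krausMap_apply, Matrix.sum_apply, Matrix.mul_apply, Fintype.sum_prod_type_right,
    Matrix.one_apply, apply_ite (starRingEnd ℂ)]

theorem isCompletelyPositive_krausMap {m m' : ℕ} (K : Matrix (Fin m') (Fin m) ℂ) :
    IsCompletelyPositive (krausMap K) := by
  intro k X hX
  rw [onFst_eq_sum (ι := Unit) (K := fun _ => K) (by simp)]
  simpa [krausMap_apply] using hX.mul_mul_conjTranspose_same _

/-- Choi's argument: the image of the unnormalised maximally entangled projection is positive, hence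
a sum of rank-one terms `v v†`. Each `v`, reshaped into a matrix, is a Kraus operator. -/
theorem IsCompletelyPositive.exists_kraus {m m' : ℕ}
    {E : Matrix (Fin m) (Fin m) ℂ →ₗ[ℂ] Matrix (Fin m') (Fin m') ℂ}
    (hE : IsCompletelyPositive E) :
    ∃ (N : ℕ) (K : Fin N → Matrix (Fin m') (Fin m) ℂ), ∀ X, E X = ∑ t, krausMap (K t) X := by
  let w : Fin m × Fin m → ℂ := fun p => if p.1 = p.2 then 1 else 0
  obtain ⟨N, v, hv⟩ := Matrix.posSemidef_iff_eq_sum_vecMulVec.1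
    (hE m _ (Matrix.posSemidef_vecMulVec_self_star w))
  refine ⟨N, fun t => Matrix.of fun a i => v t (a, i), fun X => ?_⟩
  have hs : ∀ i j a b, E (Matrix.single i j 1) a b = ∑ t, v t (a, i) * star (v t (b, j)) := by
    intro i j a b
    have h := congrFun (congrFun hv (a, i)) (b, j)
    simp only [Matrix.sum_apply, Matrix.vecMulVec_apply, Pi.star_apply] at h
    rw [← h]
    have : (Matrix.single i j 1 : Matrix (Fin m) (Fin m) ℂ) =
        Matrix.of fun i' j' => Matrix.vecMulVec w (star w) (i', i) (j', j) := by
      ext i' j'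
      simp only [Matrix.single_apply, Matrix.of_apply, Matrix.vecMulVec_apply, Pi.star_apply, w]
      by_cases h1 : i = i' <;> by_cases h2 : j = j' <;> simp [h1, h2, eq_comm]
    rw [this]
    rfl
  ext a b
  conv_lhs => rw [Matrix.matrix_eq_sum_single X]
  have hX : ∀ i j, (Matrix.single i j (X i j) : Matrix (Fin m) (Fin m) ℂ) =
      X i j • Matrix.single i j 1 := by
    intro i j
    simp
  simp only [hX, map_sum, map_smul, Matrix.sum_apply, Matrix.smul_apply, hs, smul_eq_mul,
    krausMap_apply, Matrix.mul_apply, Matrix.of_apply, Matrix.conjTranspose_apply,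
    Finset.mul_sum, Finset.sum_mul]
  rw [Finset.sum_congr rfl fun i _ => Finset.sum_comm, Finset.sum_comm]
  refine Finset.sum_congr rfl fun t _ => ?_
  rw [Finset.sum_comm]
  refine Finset.sum_congr rfl fun i _ => Finset.sum_congr rfl fun j _ => ?_
  ring

/-- Every LOCC channel is separable: it has Kraus operators of product form. -/
theorem IsLOCC.exists_product_kraus {m n m' n' : ℕ}
    {Λ : Matrix (Fin m × Fin n) (Fin m × Fin n) ℂ →ₗ[ℂ]
      Matrix (Fin m' × Fin n') (Fin m' × Fin n') ℂ} (hΛ : IsLOCC Λ) :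
    ∃ (ι : Type) (_ : Fintype ι) (A : ι → Matrix (Fin m') (Fin m) ℂ)
      (B : ι → Matrix (Fin n') (Fin n) ℂ), ∀ X, Λ X = ∑ t, krausMap (A t ⊗ₖ B t) X := by
  induction hΛ with
  | idle => exact ⟨Unit, inferInstance, fun _ => 1, fun _ => 1, fun X => by simp [krausMap_apply]⟩
  | first E hE Λ hΛ ih =>
    choose ι hι A B hAB using ih
    choose N K hK using fun i => (hE.completelyPositive i).exists_kraus
    -- A Kraus label records the outcome, a label of the remaining protocol and one of the
    -- instrument element. Only the acting party's factor is multiplied.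
    refine ⟨(i : _) × (ι i × Fin (N i)), inferInstance, fun t => A t.1 t.2.1 * K t.1 t.2.2,
      fun t => B t.1 t.2.1, fun X => ?_⟩
    rw [LinearMap.sum_apply, Fintype.sum_sigma]
    refine Finset.sum_congr rfl fun i _ => ?_
    rw [LinearMap.comp_apply, hAB, onFst_eq_sum (hK i), Fintype.sum_prod_type]
    refine Finset.sum_congr rfl fun s _ => ?_
    simp only [map_sum, krausMap_mul, ← Matrix.mul_kronecker_mul, Matrix.mul_one]
  | second E hE Λ hΛ ih =>
    choose ι hι A B hAB using ih
    choose N K hK using fun i => (hE.completelyPositive i).exists_kraus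
    refine ⟨(i : _) × (ι i × Fin (N i)), inferInstance, fun t => A t.1 t.2.1,
      fun t => B t.1 t.2.1 * K t.1 t.2.2, fun X => ?_⟩
    rw [LinearMap.sum_apply, Fintype.sum_sigma]
    refine Finset.sum_congr rfl fun i _ => ?_
    rw [LinearMap.comp_apply, hAB, onSnd_eq_sum (hK i), Fintype.sum_prod_type]
    refine Finset.sum_congr rfl fun s _ => ?_
    simp only [map_sum, krausMap_mul, ← Matrix.mul_kronecker_mul, Matrix.mul_one]

theorem trace_onFst {a a' b : Type*} [Fintype a] [Fintype a'] [Fintype b]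
    (E : Matrix a a ℂ →ₗ[ℂ] Matrix a' a' ℂ) (X : Matrix (a × b) (a × b) ℂ) :
    (onFst E X).trace = ∑ c, (E (Matrix.of fun i j => X (i, c) (j, c))).trace := by
  simp only [Matrix.trace, Matrix.diag_apply, Fintype.sum_prod_type_right]
  rfl

theorem trace_onSnd {a b b' : Type*} [Fintype a] [Fintype b] [Fintype b']
    (E : Matrix b b ℂ →ₗ[ℂ] Matrix b' b' ℂ) (X : Matrix (a × b) (a × b) ℂ) :
    (onSnd E X).trace = ∑ c, (E (Matrix.of fun i j => X (c, i) (c, j))).trace := by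
  simp only [Matrix.trace, Matrix.diag_apply, Fintype.sum_prod_type]
  rfl

theorem IsLOCC.trace_apply {m n m' n' : ℕ}
    {Λ : Matrix (Fin m × Fin n) (Fin m × Fin n) ℂ →ₗ[ℂ]
      Matrix (Fin m' × Fin n') (Fin m' × Fin n') ℂ} (hΛ : IsLOCC Λ)
    (X : Matrix (Fin m × Fin n) (Fin m × Fin n) ℂ) : (Λ X).trace = X.trace := by
  induction hΛ with
  | idle => rfl
  | first E hE Λ hΛ ih =>
    simp only [LinearMap.sum_apply, LinearMap.comp_apply, Matrix.trace_sum, ih, trace_onFst]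
    rw [Finset.sum_comm]
    simp only [hE.tracePreserving]
    simp [Matrix.trace, Fintype.sum_prod_type_right]
  | second E hE Λ hΛ ih =>
    simp only [LinearMap.sum_apply, LinearMap.comp_apply, Matrix.trace_sum, ih, trace_onSnd]
    rw [Finset.sum_comm]
    simp only [hE.tracePreserving]
    simp [Matrix.trace, Fintype.sum_prod_type]

/-- The square of the Hilbert–Schmidt norm. -/
noncomputable def hsNormSq {a b : Type*} [Fintype a] [Fintype b] (A : Matrix a b ℂ) : ℝ :=
  ∑ i, ∑ j, ‖A i j‖ ^ 2

theorem hsNormSq_kronecker {a b c e : Type*} [Fintype a] [Fintype b] [Fintype c] [Fintype e]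
    (A : Matrix a b ℂ) (B : Matrix c e ℂ) : hsNormSq (A ⊗ₖ B) = hsNormSq A * hsNormSq B := by
  simp only [hsNormSq, Fintype.sum_prod_type, Matrix.kroneckerMap_apply, norm_mul, mul_pow,
    Finset.sum_mul_sum]

theorem trace_krausMap_one {a b : Type*} [Fintype a] [Fintype b] [DecidableEq a]
    (K : Matrix b a ℂ) : (krausMap K 1).trace = hsNormSq K := by
  simp only [krausMap_apply, Matrix.mul_one, Matrix.trace, Matrix.diag_apply, Matrix.mul_apply,
    Matrix.conjTranspose_apply, hsNormSq, Complex.ofReal_sum]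
  refine Finset.sum_congr rfl fun i _ => Finset.sum_congr rfl fun j _ => ?_
  rw [Complex.star_def, Complex.mul_conj, Complex.normSq_eq_norm_sq]

theorem sum_hsNormSq_mul_hsNormSq {m n m' n' : ℕ} {ι : Type*} [Fintype ι]
    {Λ : Matrix (Fin m × Fin n) (Fin m × Fin n) ℂ →ₗ[ℂ]
      Matrix (Fin m' × Fin n') (Fin m' × Fin n') ℂ} (htr : ∀ X, (Λ X).trace = X.trace)
    {A : ι → Matrix (Fin m') (Fin m) ℂ} {B : ι → Matrix (Fin n') (Fin n) ℂ}
    (hΛ : ∀ X, Λ X = ∑ t, krausMap (A t ⊗ₖ B t) X) :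
    ∑ t, hsNormSq (A t) * hsNormSq (B t) = m * n := by
  -- Evaluating at the identity turns trace preservation into a sum of Hilbert–Schmidt norms.
  have h := htr 1
  simp only [hΛ, Matrix.trace_sum, trace_krausMap_one, hsNormSq_kronecker, Matrix.trace_one,
    Fintype.card_prod, Fintype.card_fin] at h
  exact_mod_cast h

theorem norm_sum_mul_sq_le {ι : Type*} (s : Finset ι) (f g : ι → ℂ) :
    ‖∑ x ∈ s, f x * g x‖ ^ 2 ≤ (∑ x ∈ s, ‖f x‖ ^ 2) * ∑ x ∈ s, ‖g x‖ ^ 2 := by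
  refine le_trans ?_ (Finset.sum_mul_sq_le_sq_mul_sq s (fun x => ‖f x‖) (fun x => ‖g x‖))
  gcongr
  refine (norm_sum_le _ _).trans_eq ?_
  simp

theorem hsNormSq_mul_le {a b c : Type*} [Fintype a] [Fintype b] [Fintype c]
    (A : Matrix a b ℂ) (B : Matrix b c ℂ) : hsNormSq (A * B) ≤ hsNormSq A * hsNormSq B := by
  calc hsNormSq (A * B) ≤ ∑ i, ∑ j, (∑ k, ‖A i k‖ ^ 2) * ∑ k, ‖B k j‖ ^ 2 :=
        Finset.sum_le_sum fun i _ => Finset.sum_le_sum fun j _ => norm_sum_mul_sq_le _ _ _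
    _ = _ := by
        rw [← Finset.sum_mul_sum, hsNormSq, hsNormSq, Finset.sum_comm (f := fun j k => ‖B k j‖ ^ 2)]

/-- Cauchy–Schwarz, with the trace read as the pairing of the entries of `A` with those of the
transpose of `B`. -/
theorem norm_trace_mul_sq_le {a b : Type*} [Fintype a] [Fintype b]
    (A : Matrix a b ℂ) (B : Matrix b a ℂ) :
    ‖(A * B).trace‖ ^ 2 ≤ hsNormSq A * hsNormSq B := by
  have h := norm_sum_mul_sq_le Finset.univ (fun p : a × b => A p.1 p.2) (fun p => B p.2 p.1)
  rw [Fintype.sum_prod_type, Fintype.sum_prod_type, Fintype.sum_prod_type_right] at h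
  exact h

end Kraus

/-! ### The swap fidelity as a linear functional, and the upper bound -/

section Fidelity

open scoped Kronecker

variable {d : ℕ}

theorem integral_moment_mul_moment (hd : 1 ≤ d) (i j k l i' j' k' l' : Fin d) :
    ∫ ω : StateVector d × StateVector d, moment ω.1.1 i j k l * moment ω.2.1 i' j' k' l'
      ∂((haarState d).prod (haarState d)) =
      symmetricTensor d i j k l * symmetricTensor d i' j' k' l' := by
  have := isProbabilityMeasure_haarState hd
  rw [integral_prod_mul (fun x : StateVector d => moment x.1 i j k l)
    (fun x : StateVector d => moment x.1 i' j' k' l'), integral_moment hd, integral_moment hd]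

theorem integrable_moment_mul_moment (hd : 1 ≤ d) (i j k l i' j' k' l' : Fin d) :
    Integrable (fun ω : StateVector d × StateVector d =>
      moment ω.1.1 i j k l * moment ω.2.1 i' j' k' l')
      ((haarState d).prod (haarState d)) := by
  have := isProbabilityMeasure_haarState hd
  exact integrable_of_continuous (((continuous_moment i j k l).comp continuous_fst).mul
    ((continuous_moment i' j' k' l').comp continuous_snd))

theorem pureState_productVector_apply (x y : EuclideanSpace ℂ (Fin d)) (p q : Fin d × Fin d) :
    pureState (productVector x y) p q =
      x p.1 * y p.2 * (star (x q.1) * star (y q.2)) := by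
  simp [pureState, productVector, Matrix.vecMulVec_apply]

/-- The input and the target each contain one copy of `x` and one of `y`. Regrouping by vector gives
one second moment of each, which independence allows to be averaged separately. -/
theorem trace_apply_pureState_mul
    (Λ : Matrix (Fin d × Fin d) (Fin d × Fin d) ℂ →ₗ[ℂ]
      Matrix (Fin d × Fin d) (Fin d × Fin d) ℂ) (x y : EuclideanSpace ℂ (Fin d)) :
    (Λ (pureState (productVector x y)) * pureState (productVector y x)).trace =
      ∑ r, ∑ q, ∑ s, ∑ p, Λ (Matrix.single p q 1) r s *
        (moment x p.1 s.2 q.1 r.2 * moment y p.2 s.1 q.2 r.1) := by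
  have hX : ∀ X : Matrix (Fin d × Fin d) (Fin d × Fin d) ℂ, ∀ r s,
      Λ X r s = ∑ q, ∑ p, Λ (Matrix.single p q 1) r s * X p q := by
    intro X r s
    conv_lhs => rw [Matrix.matrix_eq_sum_single X]
    have hs : ∀ i j, (Matrix.single i j (X i j) : Matrix (Fin d × Fin d) (Fin d × Fin d) ℂ) =
        X i j • Matrix.single i j 1 := by
      intro i j
      simp
    simp only [hs, map_sum, map_smul, Matrix.sum_apply, Matrix.smul_apply, smul_eq_mul]
    rw [Finset.sum_comm]
    exact Finset.sum_congr rfl fun _ _ => Finset.sum_congr rfl fun _ _ => mul_comm _ _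
  simp only [Matrix.trace, Matrix.diag_apply, Matrix.mul_apply]
  refine Finset.sum_congr rfl fun r _ => ?_
  rw [Finset.sum_comm]
  refine Finset.sum_congr rfl fun s _ => ?_
  rw [hX, Finset.sum_mul]
  refine Finset.sum_congr rfl fun q _ => ?_
  rw [Finset.sum_mul]
  refine Finset.sum_congr rfl fun p _ => ?_
  simp only [pureState_productVector_apply, moment]
  ring

/-- The average fidelity for the swap as an explicit linear functional of the channel. -/
theorem averageFidelity_swap (hd : 1 ≤ d)
    (Λ : Matrix (Fin d × Fin d) (Fin d × Fin d) ℂ →ₗ[ℂ]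
      Matrix (Fin d × Fin d) (Fin d × Fin d) ℂ) :
    averageFidelity ((haarState d).prod (haarState d))
      (fun ω : StateVector d × StateVector d => productVector ω.1.1 ω.2.1) (swapOperator d) Λ =
    (∑ r, ∑ q, ∑ s, ∑ p, Λ (Matrix.single p q 1) r s *
      (symmetricTensor d p.1 s.2 q.1 r.2 * symmetricTensor d p.2 s.1 q.2 r.1)).re := by
  have hint := fun p q r s : Fin d × Fin d =>
    (integrable_moment_mul_moment hd p.1 s.2 q.1 r.2 p.2 s.1 q.2 r.1).const_mul
      (Λ (Matrix.single p q 1) r s)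
  simp only [averageFidelity, swapOperator_productVector, trace_apply_pureState_mul]
  refine (integral_re (𝕜 := ℂ) ?_).trans (congrArg Complex.re ?_)
  · exact integrable_finsetSum _ fun r _ => integrable_finsetSum _ fun q _ =>
      integrable_finsetSum _ fun s _ => integrable_finsetSum _ fun p _ => hint p q r s
  · rw [integral_finsetSum _ fun r _ => integrable_finsetSum _ fun q _ =>
      integrable_finsetSum _ fun s _ => integrable_finsetSum _ fun p _ => hint p q r s]
    refine Finset.sum_congr rfl fun r _ => ?_
    rw [integral_finsetSum _ fun q _ =>
      integrable_finsetSum _ fun s _ => integrable_finsetSum _ fun p _ => hint p q r s]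
    refine Finset.sum_congr rfl fun q _ => ?_
    rw [integral_finsetSum _ fun s _ => integrable_finsetSum _ fun p _ => hint p q r s]
    refine Finset.sum_congr rfl fun s _ => ?_
    rw [integral_finsetSum _ fun p _ => hint p q r s]
    refine Finset.sum_congr rfl fun p _ => ?_
    rw [integral_const_mul, integral_moment_mul_moment hd]

theorem krausMap_single {a b : Type*} [Fintype a] [DecidableEq a] (K : Matrix b a ℂ) (p q : a)
    (r s : b) : krausMap K (Matrix.single p q 1) r s = K r p * star (K s q) := by
  simp [krausMap_apply, Matrix.mul_apply, Matrix.single_apply, ite_and]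

theorem ite_and_eq_mul (P Q : Prop) [Decidable P] [Decidable Q] [Decidable (P ∧ Q)] :
    (if P ∧ Q then (1 : ℂ) else 0) = (if P then 1 else 0) * (if Q then 1 else 0) := by
  split_ifs <;> simp_all

theorem ite_ite_zero (P Q : Prop) [Decidable P] [Decidable Q] (g : ℂ) :
    (if P then if Q then g else 0 else 0) =
      g * ((if P then 1 else 0) * (if Q then 1 else 0)) := by
  split_ifs <;> simp

/-- Each symmetric tensor is a sum of two products of deltas. The four combinations each pin down
`s` and `p` in terms of `r` and `q`. -/
theorem sum_mul_symmetricTensor (G : Fin d × Fin d → Fin d × Fin d → ℂ) (r q : Fin d × Fin d) :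
    ∑ s, ∑ p, G s p *
      (symmetricTensor d p.1 s.2 q.1 r.2 * symmetricTensor d p.2 s.1 q.2 r.1) =
    (G (r.1, r.2) (q.1, q.2) + G (q.2, r.2) (q.1, r.1) + G (r.1, q.1) (r.2, q.2) +
      G (q.2, q.1) (r.2, r.1)) / (d * (d + 1)) ^ 2 := by
  have h : ∀ s p : Fin d × Fin d, G s p *
      (symmetricTensor d p.1 s.2 q.1 r.2 * symmetricTensor d p.2 s.1 q.2 r.1) =
      ((if s = (r.1, r.2) then if p = (q.1, q.2) then G s p else 0 else 0) +
      (if s = (q.2, r.2) then if p = (q.1, r.1) then G s p else 0 else 0) +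
      (if s = (r.1, q.1) then if p = (r.2, q.2) then G s p else 0 else 0) +
      (if s = (q.2, q.1) then if p = (r.2, r.1) then G s p else 0 else 0)) /
        (d * (d + 1)) ^ 2 := by
    rintro ⟨s1, s2⟩ ⟨p1, p2⟩
    simp only [symmetricTensor, ite_ite_zero, Prod.mk.injEq, ite_and_eq_mul]
    generalize (d : ℂ) * (d + 1) = c
    ring
  simp only [h, ← Finset.sum_div, Finset.sum_add_distrib, Finset.sum_ite_irrel,
    Finset.sum_ite_eq', Finset.sum_const_zero, Finset.mem_univ, if_true]

/-- The four index pairings left by the deltas contract `A ⊗ B` with its conjugate in four ways,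
giving the four squared quantities in order. -/
theorem sum_krausMap_mul_symmetricTensor (A B : Matrix (Fin d) (Fin d) ℂ) :
    ∑ r, ∑ q, ∑ s, ∑ p, krausMap (A ⊗ₖ B) (Matrix.single p q 1) r s *
      (symmetricTensor d p.1 s.2 q.1 r.2 * symmetricTensor d p.2 s.1 q.2 r.1) =
    ((hsNormSq A * hsNormSq B + hsNormSq (B * A) + hsNormSq (A * B) +
      ‖(A * B).trace‖ ^ 2 : ℝ) : ℂ) / (d * (d + 1)) ^ 2 := by
  have hn : ∀ z : ℂ, ((‖z‖ ^ 2 : ℝ) : ℂ) = z * star z := by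
    intro z
    rw [Complex.star_def, Complex.mul_conj, Complex.normSq_eq_norm_sq]
  have hh : ∀ C : Matrix (Fin d) (Fin d) ℂ,
      (hsNormSq C : ℂ) = ∑ i, ∑ j, C i j * star (C i j) := by
    intro C
    simp only [hsNormSq, Complex.ofReal_sum, hn]
  rw [Finset.sum_congr rfl fun r _ => Finset.sum_congr rfl fun q _ =>
    sum_mul_symmetricTensor (fun s p => krausMap (A ⊗ₖ B) (Matrix.single p q 1) r s) r q]
  simp only [← Finset.sum_div, Finset.sum_add_distrib, krausMap_single,
    Matrix.kroneckerMap_apply, star_mul']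
  rw [Complex.ofReal_add, Complex.ofReal_add, Complex.ofReal_add, Complex.ofReal_mul, hn, hh, hh,
    hh, hh]
  congr 1
  congr 1
  congr 1
  congr 1
  · simp only [Finset.sum_mul_sum, Fintype.sum_prod_type]
    refine Finset.sum_congr rfl fun r1 _ => Finset.sum_congr rfl fun r2 _ =>
      Finset.sum_congr rfl fun q1 _ => Finset.sum_congr rfl fun q2 _ => ?_
    ring
  · simp only [Matrix.mul_apply, star_sum, Finset.sum_mul_sum, Fintype.sum_prod_type, star_mul']
    rw [Finset.sum_comm]
    refine Finset.sum_congr rfl fun r2 _ => ?_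
    rw [Finset.sum_comm]
    refine Finset.sum_congr rfl fun q1 _ => ?_
    refine Finset.sum_congr rfl fun r1 _ => Finset.sum_congr rfl fun q2 _ => ?_
    ring
  · simp only [Matrix.mul_apply, star_sum, Finset.sum_mul_sum, Fintype.sum_prod_type, star_mul']
    refine Finset.sum_congr rfl fun r1 _ => ?_
    conv_rhs => rw [Finset.sum_comm]
    refine Finset.sum_congr rfl fun r2 _ => ?_
    conv_rhs => rw [Finset.sum_comm]
  · simp only [Matrix.trace, Matrix.diag_apply, Matrix.mul_apply, star_sum, Finset.sum_mul_sum,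
      Fintype.sum_prod_type, star_mul']
    refine Finset.sum_congr rfl fun r1 _ => ?_
    conv_rhs => rw [Finset.sum_comm]
    refine Finset.sum_congr rfl fun r2 _ => ?_
    conv_rhs => rw [Finset.sum_comm]

theorem averageFidelity_swap_le (hd : 1 ≤ d)
    {Λ : Matrix (Fin d × Fin d) (Fin d × Fin d) ℂ →ₗ[ℂ]
      Matrix (Fin d × Fin d) (Fin d × Fin d) ℂ} (hΛ : IsLOCC Λ) :
    averageFidelity ((haarState d).prod (haarState d))
      (fun ω : StateVector d × StateVector d => productVector ω.1.1 ω.2.1) (swapOperator d) Λ ≤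
      (2 / ((d : ℝ) + 1)) ^ 2 := by
  obtain ⟨ι, _, A, B, hAB⟩ := hΛ.exists_product_kraus
  have hsum := sum_hsNormSq_mul_hsNormSq hΛ.trace_apply hAB
  have hd0 : (d : ℝ) ≠ 0 := by exact_mod_cast (by omega : d ≠ 0)
  have hform : averageFidelity ((haarState d).prod (haarState d))
      (fun ω : StateVector d × StateVector d => productVector ω.1.1 ω.2.1) (swapOperator d) Λ =
      ∑ t, (hsNormSq (A t) * hsNormSq (B t) + hsNormSq (B t * A t) + hsNormSq (A t * B t) +
        ‖(A t * B t).trace‖ ^ 2) / (d * (d + 1)) ^ 2 := by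
    have h : ∑ r, ∑ q, ∑ s, ∑ p, Λ (Matrix.single p q 1) r s *
        (symmetricTensor d p.1 s.2 q.1 r.2 * symmetricTensor d p.2 s.1 q.2 r.1) =
        ((∑ t, (hsNormSq (A t) * hsNormSq (B t) + hsNormSq (B t * A t) + hsNormSq (A t * B t) +
          ‖(A t * B t).trace‖ ^ 2) / (d * (d + 1)) ^ 2 : ℝ) : ℂ) := by
      have ht := fun t => sum_krausMap_mul_symmetricTensor (A t) (B t)
      push_cast at ht ⊢
      simp only [← ht, hAB, Matrix.sum_apply, Finset.sum_mul]
      conv_rhs => rw [Finset.sum_comm]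
      refine Finset.sum_congr rfl fun r _ => ?_
      conv_rhs => rw [Finset.sum_comm]
      refine Finset.sum_congr rfl fun q _ => ?_
      conv_rhs => rw [Finset.sum_comm]
      refine Finset.sum_congr rfl fun s _ => ?_
      rw [Finset.sum_comm]
    rw [averageFidelity_swap hd, h, Complex.ofReal_re]
  have hle : ∀ t, (hsNormSq (A t) * hsNormSq (B t) + hsNormSq (B t * A t) +
      hsNormSq (A t * B t) + ‖(A t * B t).trace‖ ^ 2) / ((d : ℝ) * (d + 1)) ^ 2 ≤
      4 * (hsNormSq (A t) * hsNormSq (B t)) / ((d : ℝ) * (d + 1)) ^ 2 := by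
    intro t
    have h1 := hsNormSq_mul_le (A t) (B t)
    have h2 := hsNormSq_mul_le (B t) (A t)
    have h3 := norm_trace_mul_sq_le (A t) (B t)
    gcongr
    linarith
  rw [hform]
  refine (Finset.sum_le_sum fun t _ => hle t).trans_eq ?_
  rw [← Finset.sum_div, ← Finset.mul_sum, hsum]
  field_simp
  norm_num

theorem averageFidelity_swap_le_of_limit (hd : 1 ≤ d)
    {Λ : Matrix (Fin d × Fin d) (Fin d × Fin d) ℂ →ₗ[ℂ]
      Matrix (Fin d × Fin d) (Fin d × Fin d) ℂ} (hΛ : IsLimitOfLOCC Λ) :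
    averageFidelity ((haarState d).prod (haarState d))
      (fun ω : StateVector d × StateVector d => productVector ω.1.1 ω.2.1) (swapOperator d) Λ ≤
      (2 / ((d : ℝ) + 1)) ^ 2 := by
  obtain ⟨Λs, hs, hlim⟩ := hΛ
  refine le_of_tendsto' (f := fun t => averageFidelity ((haarState d).prod (haarState d))
    (fun ω : StateVector d × StateVector d => productVector ω.1.1 ω.2.1) (swapOperator d) (Λs t))
    (x := Filter.atTop) ?_ fun t => averageFidelity_swap_le hd (hs t)
  simp only [averageFidelity_swap hd]
  refine (Complex.continuous_re.tendsto _).comp ?_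
  refine tendsto_finsetSum _ fun r _ => tendsto_finsetSum _ fun q _ =>
    tendsto_finsetSum _ fun s _ => tendsto_finsetSum _ fun p _ => ?_
  exact ((tendsto_pi_nhds.1 (tendsto_pi_nhds.1 (hlim (Matrix.single p q 1)) r)) s).mul_const _

end Fidelity

/-! ### Fidelity of the measure-and-prepare channel -/

section Attaining

open scoped Kronecker

variable {d : ℕ}

/-- The output of this channel is itself built from symmetric tensors, so exchanging the last two
indices changes nothing. The four terms are therefore equal, and each sums to `d²` because the
symmetric tensor has trace one. -/
theorem averageFidelity_swap_eq (hd : 1 ≤ d)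
    {Λ : Matrix (Fin d × Fin d) (Fin d × Fin d) ℂ →ₗ[ℂ]
      Matrix (Fin d × Fin d) (Fin d × Fin d) ℂ}
    (hΛ : ∀ X p q, Λ X p q = (d : ℂ) ^ 2 * ∑ a, ∑ b, X a b *
      (symmetricTensor d b.1 p.2 a.1 q.2 * symmetricTensor d b.2 p.1 a.2 q.1)) :
    averageFidelity ((haarState d).prod (haarState d))
      (fun ω : StateVector d × StateVector d => productVector ω.1.1 ω.2.1) (swapOperator d) Λ =
      (2 / ((d : ℝ) + 1)) ^ 2 := by
  have hd0 : (d : ℂ) ≠ 0 := by exact_mod_cast (by omega : d ≠ 0)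
  have hd1 : (d : ℂ) + 1 ≠ 0 := by exact_mod_cast (by omega : d + 1 ≠ 0)
  have hS : ∀ p q r s, Λ (Matrix.single p q 1) r s = (d : ℂ) ^ 2 *
      (symmetricTensor d q.1 r.2 p.1 s.2 * symmetricTensor d q.2 r.1 p.2 s.1) := by
    intro p q r s
    simp [hΛ, Matrix.single_apply, ite_and]
  have hflip : ∀ i j, symmetricTensor d i j j i = symmetricTensor d i j i j := by
    intro i j
    simp only [symmetricTensor]
    rw [add_comm]
  have hsum : ∑ i, ∑ j, symmetricTensor d i j i j = 1 := by
    have : ∀ i j, symmetricTensor d i j i j = (1 + if i = j then 1 else 0) / (d * (d + 1)) := by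
      intro i j
      by_cases h : i = j <;> simp [symmetricTensor, h]
    simp only [this, ← Finset.sum_div, Finset.sum_add_distrib]
    simp
    field_simp
  have hsum2 : ∑ r : Fin d × Fin d, ∑ q : Fin d × Fin d,
      symmetricTensor d q.1 r.2 q.1 r.2 * symmetricTensor d q.2 r.1 q.2 r.1 = 1 := by
    simp only [Fintype.sum_prod_type]
    calc _ = (∑ q1, ∑ r2, symmetricTensor d q1 r2 q1 r2) *
          ∑ q2, ∑ r1, symmetricTensor d q2 r1 q2 r1 := by
          rw [Finset.sum_comm (f := fun q1 r2 => symmetricTensor d q1 r2 q1 r2), Finset.sum_mul_sum,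
            Finset.sum_comm]
          refine Finset.sum_congr rfl fun r2 _ => Finset.sum_congr rfl fun r1 _ => ?_
          rw [Finset.sum_mul_sum]

      _ = 1 := by rw [hsum, one_mul]
  rw [averageFidelity_swap hd, Finset.sum_congr rfl fun r _ => Finset.sum_congr rfl fun q _ =>
    sum_mul_symmetricTensor (fun s p => Λ (Matrix.single p q 1) r s) r q]
  simp only [hS]
  have : ∀ r q : Fin d × Fin d,
      ((d : ℂ) ^ 2 * (symmetricTensor d q.1 r.2 q.1 r.2 * symmetricTensor d q.2 r.1 q.2 r.1) +
      (d : ℂ) ^ 2 * (symmetricTensor d q.1 r.2 q.1 r.2 * symmetricTensor d q.2 r.1 r.1 q.2) +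
      (d : ℂ) ^ 2 * (symmetricTensor d q.1 r.2 r.2 q.1 * symmetricTensor d q.2 r.1 q.2 r.1) +
      (d : ℂ) ^ 2 * (symmetricTensor d q.1 r.2 r.2 q.1 * symmetricTensor d q.2 r.1 r.1 q.2)) /
        (d * (d + 1)) ^ 2 = ((2 / ((d : ℝ) + 1)) ^ 2 : ℝ) *
      (symmetricTensor d q.1 r.2 q.1 r.2 * symmetricTensor d q.2 r.1 q.2 r.1) := by
    intro r q
    rw [hflip, hflip]
    push_cast
    field_simp
    ring
  simp only [this, ← Finset.mul_sum, hsum2, mul_one, Complex.ofReal_re]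

end Attaining

/-! ### A finite protocol for the uniform measurement -/

section Protocol

open scoped Kronecker

variable {d : ℕ}

theorem isInstrument_krausMap {m k : ℕ} {r : Fin k → ℕ}
    (K : ∀ i, Matrix (Fin (r i)) (Fin m) ℂ)
    (hK : ∑ i, (K i).conjTranspose * K i = 1) : IsInstrument fun i => krausMap (K i) where
  completelyPositive i := isCompletelyPositive_krausMap (K i)
  tracePreserving X := by
    have h : ∀ i, (krausMap (K i) X).trace = ((K i).conjTranspose * K i * X).trace := by
      intro i
      rw [krausMap_apply, Matrix.trace_mul_comm, ← Matrix.mul_assoc]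
    simp only [h, ← Matrix.trace_sum, ← Matrix.sum_mul, hK, Matrix.one_mul]

theorem krausMap_smul_vecMulVec {a b : Type*} [Fintype a] (c : ℝ) (u : b → ℂ) (v : a → ℂ)
    (X : Matrix a a ℂ) (p q : b) :
    krausMap ((c : ℂ) • Matrix.vecMulVec u (star v)) X p q =
      (c : ℂ) ^ 2 * ((X * Matrix.vecMulVec v (star v)).trace * Matrix.vecMulVec u (star u) p q) := by
  simp only [krausMap_apply, Matrix.mul_apply, Matrix.trace, Matrix.diag_apply,
    Matrix.conjTranspose_apply, Matrix.smul_apply, Matrix.vecMulVec_apply, Pi.star_apply,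
    star_mul', star_star, smul_eq_mul, Finset.sum_mul, Finset.mul_sum]
  rw [Finset.sum_comm]
  refine Finset.sum_congr rfl fun i _ => Finset.sum_congr rfl fun j _ => ?_
  simp
  ring

theorem sum_moment_contract {x : EuclideanSpace ℂ (Fin d)} (hx : ‖x‖ = 1) (i k : Fin d) :
    ∑ j, moment x i j k j = x i * star (x k) := by
  have h := sum_mul_star_of_norm_eq_one hx
  calc ∑ j, moment x i j k j = x i * star (x k) * ∑ j, x j * star (x j) := by
        rw [Finset.mul_sum]
        refine Finset.sum_congr rfl fun j _ => ?_
        simp only [moment]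
        ring
    _ = _ := by rw [h, mul_one]

/-- A finite design, with weights rescaled by `d`, is a measurement. -/
theorem design_resolution (hd : 1 ≤ d) {n : ℕ} {w : Fin n → ℝ}
    {x : Fin n → EuclideanSpace ℂ (Fin d)} (hx : ∀ s, ‖x s‖ = 1)
    (hdes : ∀ i j k l, ∑ s, (w s : ℂ) * moment (x s) i j k l = symmetricTensor d i j k l)
    (i k : Fin d) : ∑ s, (d * w s : ℂ) * (x s i * star (x s k)) = if i = k then 1 else 0 := by
  have hd0 : (d : ℂ) ≠ 0 := by exact_mod_cast (by omega : d ≠ 0)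
  have hd1 : (d : ℂ) + 1 ≠ 0 := by exact_mod_cast (by omega : d + 1 ≠ 0)
  -- As the vectors are normalised, contracting one index pair of the second moments yields the
  -- first moments, so a 2-design resolves the identity.
  calc _ = d * ∑ j, ∑ s, (w s : ℂ) * moment (x s) i j k j := by
        rw [Finset.sum_comm, Finset.mul_sum]
        refine Finset.sum_congr rfl fun s _ => ?_
        rw [← sum_moment_contract (hx s), Finset.mul_sum, Finset.mul_sum]
        refine Finset.sum_congr rfl fun j _ => ?_
        ring
    _ = d * ∑ j, ((if i = k then 1 else 0) + if i = j then (if i = k then 1 else 0) else 0) /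
          ((d : ℂ) * (d + 1)) := by
        congr 1
        refine Finset.sum_congr rfl fun j _ => ?_
        rw [hdes, symmetricTensor]
        congr 2
        · simp
        · by_cases h1 : i = j
          · subst h1; simp
          · simp [h1]
    _ = _ := by
        rw [← Finset.sum_div, Finset.sum_add_distrib]
        simp only [Finset.sum_const, Finset.card_univ, Fintype.card_fin, nsmul_eq_mul,
          Finset.sum_ite_eq, Finset.mem_univ, if_true]
        split_ifs
        · field_simp
        · simp

theorem trace_mul_pureState_mul_pureState (X : Matrix (Fin d × Fin d) (Fin d × Fin d) ℂ)
    (x y : EuclideanSpace ℂ (Fin d)) (p q : Fin d × Fin d) :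
    (X * pureState (productVector x y)).trace * pureState (productVector y x) p q =
      ∑ a, ∑ b, X a b * (moment x b.1 p.2 a.1 q.2 * moment y b.2 p.1 a.2 q.1) := by
  simp only [Matrix.trace, Matrix.diag_apply, Matrix.mul_apply, Finset.sum_mul]
  refine Finset.sum_congr rfl fun a _ => Finset.sum_congr rfl fun b _ => ?_
  simp only [pureState_productVector_apply, moment]
  ring

/-- The measure-and-prepare protocol: both parties measure with a finite design, announce their
outcomes, and prepare the state announced by the other party. -/
theorem exists_isLOCC_measurePrepare (hd : 1 ≤ d) :
    ∃ Λ : Matrix (Fin d × Fin d) (Fin d × Fin d) ℂ →ₗ[ℂ]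
      Matrix (Fin d × Fin d) (Fin d × Fin d) ℂ, IsLOCC Λ ∧
      ∀ X p q, Λ X p q = (d : ℂ) ^ 2 * ∑ a, ∑ b, X a b *
        (symmetricTensor d b.1 p.2 a.1 q.2 * symmetricTensor d b.2 p.1 a.2 q.1) := by
  obtain ⟨n, w, x, hw, hx, hdes⟩ := exists_finite_design hd
  have hres := design_resolution hd hx hdes
  have hsq : ∀ s, ((√(d * w s) : ℝ) : ℂ) * ((√(d * w s) : ℝ) : ℂ) = d * w s := by
    intro s
    rw [← Complex.ofReal_mul, Real.mul_self_sqrt (mul_nonneg (Nat.cast_nonneg d) (hw s))]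
    push_cast
    rfl
  -- The first party measures, keeping a one-dimensional system. The second party measures and at
  -- once prepares the announced `x s`. The first party then prepares `x t` by the isometry `K₃ t`,
  -- a one-outcome instrument.
  let K₁ : Fin n → Matrix (Fin 1) (Fin d) ℂ := fun s =>
    Matrix.of fun _ a => (√(d * w s) : ℝ) * star (x s a)
  let K₂ : Fin n → Fin n → Matrix (Fin d) (Fin d) ℂ := fun s t =>
    Matrix.of fun a b => (√(d * w t) : ℝ) * (x s a * star (x t b))
  let K₃ : Fin n → Matrix (Fin d) (Fin 1) ℂ := fun t => Matrix.of fun a _ => x t a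
  have h₁ : ∑ s, (K₁ s).conjTranspose * K₁ s = 1 := by
    ext a b
    rw [Matrix.one_apply, ← hres a b, Matrix.sum_apply]
    refine Finset.sum_congr rfl fun s _ => ?_
    rw [← hsq]
    simp [K₁, Matrix.mul_apply]
    ring
  have h₂ : ∀ s, ∑ t, (K₂ s t).conjTranspose * K₂ s t = 1 := by
    intro s
    ext a b
    rw [Matrix.one_apply, ← hres a b, Matrix.sum_apply]
    refine Finset.sum_congr rfl fun t _ => ?_
    rw [← hsq]
    calc _ = ((√(d * w t) : ℝ) : ℂ) * ((√(d * w t) : ℝ) : ℂ) * (x t a * star (x t b)) *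
          ∑ c, x s c * star (x s c) := by
          rw [Finset.mul_sum, Matrix.mul_apply]
          refine Finset.sum_congr rfl fun c _ => ?_
          simp [K₂]
          ring
      _ = _ := by rw [sum_mul_star_of_norm_eq_one (hx s), mul_one]
  have h₃ : ∀ t, ∑ _i : Fin 1, (K₃ t).conjTranspose * K₃ t = 1 := by
    intro t
    ext a b
    have := sum_mul_star_of_norm_eq_one (hx t)
    simp only [mul_comm (x t _)] at this
    rw [Subsingleton.elim b a, Matrix.one_apply_eq]
    simpa [K₃, Matrix.mul_apply] using this
  refine ⟨_, IsLOCC.first (r := fun _ => 1) (fun s => krausMap (K₁ s)) (isInstrument_krausMap K₁ h₁)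
    _ fun s => IsLOCC.second (r := fun _ => d) (fun t => krausMap (K₂ s t))
      (isInstrument_krausMap (K₂ s) (h₂ s)) _ fun t =>
        IsLOCC.first (k := 1) (r := fun _ => d) (fun _ => krausMap (K₃ t))
          (isInstrument_krausMap (fun _ => K₃ t) (h₃ t)) (fun _ => LinearMap.id)
          fun _ => IsLOCC.idle, fun X p q => ?_⟩
  have hfst : ∀ {a b c : ℕ} (K : Matrix (Fin b) (Fin a) ℂ)
      (Y : Matrix (Fin a × Fin c) (Fin a × Fin c) ℂ),
      onFst (krausMap K) Y = krausMap (K ⊗ₖ (1 : Matrix (Fin c) (Fin c) ℂ)) Y := by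
    intro a b c K Y
    rw [onFst_eq_sum (ι := Unit) (K := fun _ => K) (by simp)]
    simp
  have hsnd : ∀ {a b c : ℕ} (K : Matrix (Fin b) (Fin a) ℂ)
      (Y : Matrix (Fin c × Fin a) (Fin c × Fin a) ℂ),
      onSnd (krausMap K) Y = krausMap ((1 : Matrix (Fin c) (Fin c) ℂ) ⊗ₖ K) Y := by
    intro a b c K Y
    rw [onSnd_eq_sum (ι := Unit) (K := fun _ => K) (by simp)]
    simp
  -- The whole branch with outcomes `s, t` is one rank-one Kraus operator, testing for `x s ⊗ x t`
  -- and preparing `x t ⊗ x s`.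
  have hK : ∀ s t, (K₃ t * K₁ s) ⊗ₖ K₂ s t = ((√(d * w s) * √(d * w t) : ℝ) : ℂ) •
      Matrix.vecMulVec (productVector (x t) (x s)).ofLp
        (star (productVector (x s) (x t)).ofLp) := by
    intro s t
    ext ⟨a1, a2⟩ ⟨b1, b2⟩
    simp [K₁, K₂, K₃, Matrix.mul_apply, Matrix.vecMulVec_apply, productVector]
    ring
  simp only [LinearMap.sum_apply, LinearMap.comp_apply, hfst, hsnd, krausMap_mul,
    ← Matrix.mul_kronecker_mul, Matrix.mul_one, Matrix.one_mul, Finset.univ_unique,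
    Finset.sum_singleton, LinearMap.id_apply, Matrix.sum_apply, hK]
  have hterm : ∀ s t, krausMap (((√(d * w s) * √(d * w t) : ℝ) : ℂ) •
      Matrix.vecMulVec (productVector (x t) (x s)).ofLp
        (star (productVector (x s) (x t)).ofLp)) X p q = (d : ℂ) ^ 2 * ∑ a, ∑ b, X a b *
        ((w s * moment (x s) b.1 p.2 a.1 q.2) * (w t * moment (x t) b.2 p.1 a.2 q.1)) := by
    intro s t
    rw [krausMap_smul_vecMulVec]
    have := trace_mul_pureState_mul_pureState X (x s) (x t) p q
    simp only [pureState] at this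
    rw [this]
    have hc : ((√(d * w s) * √(d * w t) : ℝ) : ℂ) ^ 2 = d ^ 2 * (w s * w t) := by
      push_cast
      rw [mul_pow, pow_two, pow_two, hsq, hsq]
      ring
    rw [hc, mul_assoc]
    congr 1
    simp only [Finset.mul_sum]
    refine Finset.sum_congr rfl fun a _ => Finset.sum_congr rfl fun b _ => ?_
    ring
  refine (Finset.sum_congr rfl fun s _ => Finset.sum_congr rfl fun t _ => hterm s t).trans ?_
  -- The design property is used here: the weighted sums over `s` and `t` are exactly the two Haar
  -- second moments.
  simp only [← hdes, Finset.sum_mul_sum]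
  simp only [Finset.mul_sum]
  rw [Finset.sum_congr rfl fun s _ => Finset.sum_comm, Finset.sum_comm]
  refine Finset.sum_congr rfl fun a _ => ?_
  rw [Finset.sum_congr rfl fun s _ => Finset.sum_comm, Finset.sum_comm]

theorem integral_measurePrepare (hd : 1 ≤ d) (X : Matrix (Fin d × Fin d) (Fin d × Fin d) ℂ)
    (p q : Fin d × Fin d) :
    ∫ ω : StateVector d × StateVector d,
      (X * pureState (productVector ω.1.1 ω.2.1)).trace *
        pureState (productVector ω.2.1 ω.1.1) p q ∂((haarState d).prod (haarState d)) =
      ∑ a, ∑ b, X a b *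
        (symmetricTensor d b.1 p.2 a.1 q.2 * symmetricTensor d b.2 p.1 a.2 q.1) := by
  have hint := fun a b : Fin d × Fin d =>
    (integrable_moment_mul_moment hd b.1 p.2 a.1 q.2 b.2 p.1 a.2 q.1).const_mul (X a b)
  simp only [trace_mul_pureState_mul_pureState]
  rw [integral_finsetSum _ fun a _ => integrable_finsetSum _ fun b _ => hint a b]
  refine Finset.sum_congr rfl fun a _ => ?_
  rw [integral_finsetSum _ fun b _ => hint a b]
  refine Finset.sum_congr rfl fun b _ => ?_
  rw [integral_const_mul, integral_moment_mul_moment hd]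

end Protocol

theorem mainTheorem6 (d : ℕ) (hd : 1 ≤ d) :
    let μ : Measure (StateVector d × StateVector d) := (haarState d).prod (haarState d)
    let ens : StateVector d × StateVector d → EuclideanSpace ℂ (Fin d × Fin d) :=
      fun ω => productVector ω.1.1 ω.2.1
    -- no LOCC channel, nor any limit of LOCC channels, exceeds the bound
    (∀ Λ : Matrix (Fin d × Fin d) (Fin d × Fin d) ℂ →ₗ[ℂ]
        Matrix (Fin d × Fin d) (Fin d × Fin d) ℂ,
      (IsLOCC Λ ∨ IsLimitOfLOCC Λ) →
        averageFidelity μ ens (swapOperator d) Λ ≤ (2 / ((d : ℝ) + 1)) ^ 2) ∧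
    -- both parties measuring with the uniform POVM and preparing the outcome on the
    -- other side is an LOCC channel that attains it
    (∃ Λ : Matrix (Fin d × Fin d) (Fin d × Fin d) ℂ →ₗ[ℂ]
        Matrix (Fin d × Fin d) (Fin d × Fin d) ℂ,
      IsLOCC Λ ∧
      (∀ X p q, Λ X p q = (d : ℂ) ^ 2 * ∫ ω, Matrix.trace (X * pureState (ens ω)) *
        pureState (productVector ω.2.1 ω.1.1) p q ∂μ) ∧
      averageFidelity μ ens (swapOperator d) Λ = (2 / ((d : ℝ) + 1)) ^ 2) ∧
    simulationFidelity μ ens (swapOperator d) = (2 / ((d : ℝ) + 1)) ^ 2 := by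
  intro μ ens
  obtain ⟨Λ, hΛ, hΛX⟩ := exists_isLOCC_measurePrepare hd
  have hbound : ∀ Λ' : Matrix (Fin d × Fin d) (Fin d × Fin d) ℂ →ₗ[ℂ]
      Matrix (Fin d × Fin d) (Fin d × Fin d) ℂ, (IsLOCC Λ' ∨ IsLimitOfLOCC Λ') →
      averageFidelity μ ens (swapOperator d) Λ' ≤ (2 / ((d : ℝ) + 1)) ^ 2 :=
    fun Λ' h => h.elim (averageFidelity_swap_le hd) (averageFidelity_swap_le_of_limit hd)
  have hval : averageFidelity μ ens (swapOperator d) Λ = (2 / ((d : ℝ) + 1)) ^ 2 :=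
    averageFidelity_swap_eq hd hΛX
  refine ⟨hbound, ⟨Λ, hΛ, fun X p q => ?_, hval⟩, ?_⟩
  · rw [hΛX, ← integral_measurePrepare hd]
  · refine IsGreatest.csSup_eq ⟨⟨Λ, hΛ, hval⟩, ?_⟩
    rintro _ ⟨Λ', h', rfl⟩
    exact hbound Λ' (Or.inl h')
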